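/- For a finite simple graph $G$ on $n(G)$ vertices, a pebbling step removes two pebbles from a vertex and places one pebble at an adjacent vertex. The pebbling number $f(G)$ is the smallest integer $t\ge 0$ such that, for every distribution of $t$ pebbles onto the vertices of $G$ and every root vertex $r$, some finite (possibly empty) sequence of pebbling steps leads to a distribution with at least one pebble on $r$; put $f(G)=\infty$ if there is no such $t$ (as is the case for every disconnected graph). The graph $G$ is called Class $0$ if $f(G)=n(G)$. Let $p=p(n)\in[0,1]$ and let $G(n,p)$ be the random graph on $n$ labelled vertices in which each edge is included independently with probability $p$. Then: (a) for every fixed real $d>0$, if $pn/(n\log n)^{1/d}\to\infty$ as $n\to\infty$, then $\Pr(G(n,p)\text{ is Class }0)\to 1$ as $n\to\infty$; (b) if $pn/\log n\to 0$ as $n\to\infty$, then $\Pr(G(n,p)\text{ is Class }0)\to 0$ as $n\to\infty$. -/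

import Mathlib

namespace SimpleGraph

/-- A single pebbling step on `G`: two pebbles are removed from a vertex `u` and one pebble is
placed at a vertex `v` adjacent to `u`; all other pebbles (counted by `E`) stay where they are. -/
def PebblingStep {V : Type*} [DecidableEq V] (G : SimpleGraph V) (D D' : V → ℕ) : Prop :=
  ∃ (u v : V) (E : V → ℕ), G.Adj u v ∧ D = E + Pi.single u 2 ∧ D' = E + Pi.single v 1

/-- The distribution `D` is `r`-solvable: by some finite (possibly empty) sequence of pebbling
steps one can reach a distribution with a pebble on the root `r`. -/
def PebblingSolvableAt {V : Type*} [DecidableEq V] (G : SimpleGraph V) (D : V → ℕ) (r : V) :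
    Prop :=
  ∃ D' : V → ℕ, Relation.ReflTransGen G.PebblingStep D D' ∧ 1 ≤ D' r

/-- The distribution `D` is solvable: it is `r`-solvable for every root `r`. -/
def PebblingSolvable {V : Type*} [DecidableEq V] (G : SimpleGraph V) (D : V → ℕ) : Prop :=
  ∀ r : V, G.PebblingSolvableAt D r

/-- The pebbling number of `G`: the smallest `t` such that every distribution of `t` pebbles on
the vertices of `G` is solvable. It is `⊤` if there is no such `t` (as happens for graphs that are
not connected). -/
noncomputable def pebblingNumber {V : Type*} [Fintype V] [DecidableEq V] (G : SimpleGraph V) :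
    ℕ∞ :=
  ⨅ (t : ℕ) (_ : ∀ D : V → ℕ, ∑ v, D v = t → G.PebblingSolvable D), (t : ℕ∞)

/-- `G` is of Class 0: its pebbling number equals its number of vertices. -/
def IsClassZero {V : Type*} [Fintype V] [DecidableEq V] (G : SimpleGraph V) : Prop :=
  G.pebblingNumber = (Fintype.card V : ℕ∞)

end SimpleGraph

/-!
Call a graph expanding with factor `A` if every nonempty set `S` of vertices has at least `A * |S|`
vertices, or three quarters of all vertices, in its closed neighbourhood.

Dense regime. The hypothesis forces `p * n ≥ n ^ (2 * β)` for a constant `β > 0`, and a union bound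
shows that with high probability the random graph expands with a factor `A` of order `n ^ β`. It
remains to see that an expanding graph is of Class 0. Its balls of radius `I` (a constant) contain
more than half of the vertices, so that every vertex is within distance `2 * I` of the root, and
`K = 4 ^ I` pebbles on one vertex are enough. Suppose `n` pebbles are placed so that no vertex can
collect `K` of them. Then the number of empty vertices is at most `K` times the number of vertices
with at least two pebbles. From a vertex with at least two pebbles, pebbles can be pushed along
occupied vertices; the sets swept out in this way are the loaded sets (`SimpleGraph.IsLoaded`), and
disjoint loaded sets deliver one pebble each to any vertex in all of their closed neighbourhoods.
Hence the closed neighbourhoods of disjoint loaded sets have total size at most `K * n`.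

If fewer than `A / 2` vertices are empty, they cannot separate a maximal loaded set from the root
(`SimpleGraph.IsExpanding.pebblingSolvableAt_of_few_empty`). Otherwise there are many vertices with
at least two pebbles, and disjoint loaded sets are grown around them in rounds, each of which
multiplies their size by `L`, of order `n ^ β`, at the cost of at most half of the sets
(`SimpleGraph.IsExpanding.exists_isLoadedFamily_mul`): sets unable to grow would have their closed
neighbourhoods inside the few empty vertices and the family itself, against expansion. As
`L ^ I > n`, after `I` rounds a set has more elements than the graph has vertices, a contradiction.

Sparse regime. By the second moment method there is an isolated vertex with high probability, and
then the pebbling number is infinite.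
-/

namespace SimpleGraph

variable {V : Type*} [DecidableEq V] {G : SimpleGraph V}

/-! ### Sequences of pebbling steps -/

lemma reflTransGen_pebblingStep_add {D E : V → ℕ}
    (h : Relation.ReflTransGen G.PebblingStep D E) (F : V → ℕ) :
    Relation.ReflTransGen G.PebblingStep (D + F) (E + F) := by
  induction h with
  | refl => exact Relation.ReflTransGen.refl
  | tail _ hstep ih =>
    obtain ⟨u, v, E, hadj, rfl, rfl⟩ := hstep
    exact ih.tail ⟨u, v, E + F, hadj, add_right_comm _ _ _, add_right_comm _ _ _⟩

lemma reflTransGen_pebblingStep_add_add {D D' E E' : V → ℕ}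
    (h : Relation.ReflTransGen G.PebblingStep D E)
    (h' : Relation.ReflTransGen G.PebblingStep D' E') :
    Relation.ReflTransGen G.PebblingStep (D + D') (E + E') := by
  refine (reflTransGen_pebblingStep_add h D').trans ?_
  rw [add_comm E, add_comm E]
  exact reflTransGen_pebblingStep_add h' E

lemma reflTransGen_pebblingStep_sum {ι : Type*} (s : Finset ι) {D E : ι → V → ℕ}
    (h : ∀ i ∈ s, Relation.ReflTransGen G.PebblingStep (D i) (E i)) :
    Relation.ReflTransGen G.PebblingStep (∑ i ∈ s, D i) (∑ i ∈ s, E i) := by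
  classical
  induction s using Finset.induction_on with
  | empty => exact Relation.ReflTransGen.refl
  | insert a s ha ih =>
    rw [Finset.sum_insert ha, Finset.sum_insert ha]
    exact reflTransGen_pebblingStep_add_add (h a (Finset.mem_insert_self a s))
      (ih fun i hi => h i (Finset.mem_insert_of_mem hi))

/-- A sequence of steps available to `D` is available to every `D' ≥ D`. -/
lemma reflTransGen_pebblingStep_of_le {D D' E : V → ℕ}
    (h : Relation.ReflTransGen G.PebblingStep D E) (hD : D ≤ D') :
    ∃ E', Relation.ReflTransGen G.PebblingStep D' E' ∧ E ≤ E' := by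
  refine ⟨E + (D' - D), ?_, le_self_add⟩
  have := reflTransGen_pebblingStep_add h (D' - D)
  rwa [add_tsub_cancel_of_le hD] at this

lemma reflTransGen_pebblingStep_single {u v : V} (h : G.Adj u v) (j : ℕ) :
    Relation.ReflTransGen G.PebblingStep (Pi.single u (2 * j)) (Pi.single v j) := by
  induction j with
  | zero => simpa using Relation.ReflTransGen.refl
  | succ j ih =>
    have h1 : Relation.ReflTransGen G.PebblingStep (Pi.single u 2) (Pi.single v 1) :=
      Relation.ReflTransGen.single ⟨u, v, 0, h, (zero_add _).symm, (zero_add _).symm⟩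
    rw [mul_add, Pi.single_add, Pi.single_add]
    exact reflTransGen_pebblingStep_add_add ih h1

lemma Walk.reflTransGen_pebblingStep_single {u v : V} (q : G.Walk u v) :
    Relation.ReflTransGen G.PebblingStep (Pi.single u (2 ^ q.length)) (Pi.single v 1) := by
  induction q with
  | nil => exact Relation.ReflTransGen.refl
  | cons h q ih =>
    rw [Walk.length_cons, pow_succ']
    exact (SimpleGraph.reflTransGen_pebblingStep_single h _).trans ih

lemma Walk.pebblingSolvableAt {u v : V} (q : G.Walk u v) {D E : V → ℕ}
    (h : Relation.ReflTransGen G.PebblingStep D E) (hE : 2 ^ q.length ≤ E u) :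
    G.PebblingSolvableAt D v := by
  have hle : Pi.single u (2 ^ q.length) ≤ E := by
    intro x
    by_cases hx : x = u
    · subst hx; simpa using hE
    · simp [hx]
  obtain ⟨E', h1, h2⟩ := reflTransGen_pebblingStep_of_le q.reflTransGen_pebblingStep_single hle
  exact ⟨E', h.trans h1, by simpa using h2 v⟩

/-! ### Loaded sets -/

/-- The part of the distribution `D` that lies on `T`. -/
def pebblesOn (D : V → ℕ) (T : Finset V) : V → ℕ := fun v => if v ∈ T then D v else 0

lemma pebblesOn_le (D : V → ℕ) (T : Finset V) : pebblesOn D T ≤ D := by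
  intro v
  unfold pebblesOn
  split_ifs <;> simp

lemma pebblesOn_insert (D : V → ℕ) {T : Finset V} {y : V} (hy : y ∉ T) :
    pebblesOn D (insert y T) = pebblesOn D T + Pi.single y (D y) := by
  funext v
  by_cases hv : v = y
  · subst hv; simp [pebblesOn, hy]
  · simp [pebblesOn, hv]

lemma sum_pebblesOn_le {ι : Type*} (D : V → ℕ) (s : Finset ι) (T : ι → Finset V)
    (hT : (s : Set ι).PairwiseDisjoint T) : ∑ i ∈ s, pebblesOn D (T i) ≤ D := by
  classical
  intro v
  rw [Finset.sum_apply]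
  by_cases h : ∃ i ∈ s, v ∈ T i
  · obtain ⟨i, hi, hv⟩ := h
    rw [Finset.sum_eq_single_of_mem i hi]
    · exact pebblesOn_le D _ v
    · intro j hj hji
      have : v ∉ T j := fun hvj => Finset.disjoint_left.1 (hT hj hi hji) hvj hv
      simp [pebblesOn, this]
  · push Not at h
    rw [Finset.sum_eq_zero]
    · exact Nat.zero_le _
    · intro i hi
      simp [pebblesOn, h i hi]

variable (G) in
/-- `T` is loaded by `D`: using only the pebbles on `T`, two pebbles can be brought to any
prescribed vertex of `T`. -/
def IsLoaded (D : V → ℕ) (T : Finset V) : Prop :=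
  ∀ x ∈ T, ∃ E, Relation.ReflTransGen G.PebblingStep (pebblesOn D T) E ∧ 2 ≤ E x

lemma isLoaded_singleton {D : V → ℕ} {u : V} (h : 2 ≤ D u) : G.IsLoaded D {u} := by
  intro x hx
  rw [Finset.mem_singleton] at hx
  subst hx
  exact ⟨_, Relation.ReflTransGen.refl, by simpa [pebblesOn] using h⟩

/-- If two pebbles can be brought to `x`, one of them can be pushed on to a neighbour. -/
lemma reflTransGen_pebblingStep_push {D E : V → ℕ} {x y : V}
    (h : Relation.ReflTransGen G.PebblingStep D E) (hx : 2 ≤ E x) (hxy : G.Adj x y) :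
    ∃ E', Relation.ReflTransGen G.PebblingStep D E' ∧ 1 ≤ E' y := by
  have hle : Pi.single x 2 ≤ E := by
    intro z
    by_cases hz : z = x
    · subst hz; simpa using hx
    · simp [hz]
  obtain ⟨E', h1, h2⟩ :=
    reflTransGen_pebblingStep_of_le (reflTransGen_pebblingStep_single hxy 1) hle
  exact ⟨E', h.trans h1, by simpa using h2 y⟩

/-- Loaded sets grow along occupied vertices: a pebble pushed onto an occupied vertex makes two
pebbles there. -/
lemma IsLoaded.insert {D : V → ℕ} {T : Finset V} (h : G.IsLoaded D T) {x y : V} (hx : x ∈ T)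
    (hxy : G.Adj x y) (hyT : y ∉ T) (hy : 1 ≤ D y) : G.IsLoaded D (insert y T) := by
  intro z hz
  rw [pebblesOn_insert D hyT]
  rcases Finset.mem_insert.1 hz with rfl | hz
  · obtain ⟨E, hE, hEx⟩ := h x hx
    obtain ⟨E', hE', hy'⟩ := reflTransGen_pebblingStep_push hE hEx hxy
    refine ⟨_, reflTransGen_pebblingStep_add hE' _, ?_⟩
    simp only [Pi.add_apply, Pi.single_eq_same]
    omega
  · obtain ⟨E, hE, hEz⟩ := h z hz
    exact ⟨_, reflTransGen_pebblingStep_add hE _, hEz.trans (Nat.le_add_right _ _)⟩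

variable (G) in
/-- A family of pairwise disjoint loaded sets of occupied vertices, indexed by `W`, each of
cardinality between `m` and `M`. -/
structure IsLoadedFamily (D : V → ℕ) (W : Finset V) (m M : ℕ) (T : V → Finset V) :
    Prop where
  disjoint : (W : Set V).PairwiseDisjoint T
  loaded : ∀ u ∈ W, G.IsLoaded D (T u)
  occupied : ∀ u ∈ W, ∀ x ∈ T u, 1 ≤ D x
  le_card : ∀ u ∈ W, m ≤ (T u).card
  card_le : ∀ u ∈ W, (T u).card ≤ M

lemma isLoadedFamily_singleton {D : V → ℕ} {W : Finset V} (hW : ∀ u ∈ W, 2 ≤ D u) {M : ℕ}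
    (hM : 1 ≤ M) : G.IsLoadedFamily D W 1 M fun u => {u} where
  disjoint := by
    intro u _ v _ huv
    simpa [Function.onFun] using huv
  loaded u hu := isLoaded_singleton (hW u hu)
  occupied u hu x hx := by
    rw [Finset.mem_singleton.1 hx]
    exact one_le_two.trans (hW u hu)
  le_card u _ := by simp
  card_le u _ := by simpa using hM

variable [Fintype V]

open Classical in
variable (G) in
/-- The closed neighbourhood of a set of vertices: the set together with all its neighbours. -/
noncomputable def closedNbhd (S : Finset V) : Finset V :=
  Finset.univ.filter fun w => w ∈ S ∨ ∃ v ∈ S, G.Adj v w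

lemma mem_closedNbhd {S : Finset V} {w : V} :
    w ∈ G.closedNbhd S ↔ w ∈ S ∨ ∃ v ∈ S, G.Adj v w := by
  simp [closedNbhd]

lemma subset_closedNbhd (S : Finset V) : S ⊆ G.closedNbhd S :=
  fun _ hv => mem_closedNbhd.2 (Or.inl hv)

lemma IsLoaded.exists_one_le {D : V → ℕ} {T : Finset V} (h : G.IsLoaded D T) {w : V}
    (hw : w ∈ G.closedNbhd T) :
    ∃ E, Relation.ReflTransGen G.PebblingStep (pebblesOn D T) E ∧ 1 ≤ E w := by
  rcases mem_closedNbhd.1 hw with hw | ⟨v, hv, hvw⟩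
  · obtain ⟨E, hE, hEw⟩ := h w hw
    exact ⟨E, hE, by omega⟩
  · obtain ⟨E, hE, hEv⟩ := h v hv
    exact reflTransGen_pebblingStep_push hE hEv hvw

/-- Disjoint loaded sets with a common vertex `w` in their closed neighbourhoods deliver one pebble
each to `w`. -/
lemma exists_card_le_of_isLoaded {ι : Type*} {D : V → ℕ} (s : Finset ι) (T : ι → Finset V)
    (hT : (s : Set ι).PairwiseDisjoint T) (hl : ∀ i ∈ s, G.IsLoaded D (T i)) {w : V}
    (hw : ∀ i ∈ s, w ∈ G.closedNbhd (T i)) :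
    ∃ E, Relation.ReflTransGen G.PebblingStep D E ∧ s.card ≤ E w := by
  classical
  have hE : ∀ i, ∃ E : V → ℕ, i ∈ s →
      Relation.ReflTransGen G.PebblingStep (pebblesOn D (T i)) E ∧ 1 ≤ E w := by
    intro i
    by_cases hi : i ∈ s
    · obtain ⟨E, hE⟩ := (hl i hi).exists_one_le (hw i hi)
      exact ⟨E, fun _ => hE⟩
    · exact ⟨0, fun h => absurd h hi⟩
  choose E hE using hE
  obtain ⟨E', h1, h2⟩ := reflTransGen_pebblingStep_of_le
    (reflTransGen_pebblingStep_sum s fun i hi => (hE i hi).1) (sum_pebblesOn_le D s T hT)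
  refine ⟨E', h1, le_trans ?_ (h2 w)⟩
  rw [Finset.sum_apply, Finset.card_eq_sum_ones]
  exact Finset.sum_le_sum fun i hi => (hE i hi).2

/-- In a family of largest total size, a member below the size cap can only be adjacent to empty
vertices and to vertices already used by the family. -/
lemma IsLoadedFamily.exists_maximal {D : V → ℕ} {W : Finset V} {m M : ℕ} {T : V → Finset V}
    (h : G.IsLoadedFamily D W m M T) :
    ∃ T', G.IsLoadedFamily D W m M T' ∧ ∀ u ∈ W, (T' u).card < M →
      ∀ y ∈ G.closedNbhd (T' u), D y = 0 ∨ ∃ v ∈ W, y ∈ T' v := by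
  classical
  obtain ⟨T', hT', hmax⟩ := Finset.exists_max_image
    (Finset.univ.filter fun T => G.IsLoadedFamily D W m M T) (fun T => ∑ u ∈ W, (T u).card)
    ⟨T, by simpa using h⟩
  simp only [Finset.mem_filter, Finset.mem_univ, true_and] at hT' hmax
  refine ⟨T', hT', fun u hu hcard y hy => ?_⟩
  by_contra! hcon
  obtain ⟨hy0, hyT⟩ := hcon
  rcases mem_closedNbhd.1 hy with hy | ⟨x, hx, hxy⟩
  · exact hyT u hu hy
  have hyu := hyT u hu
  have hne : ∀ v, v ≠ u → Function.update T' u (insert y (T' u)) v = T' v :=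
    fun v hv => Function.update_of_ne hv _ _
  have heq : Function.update T' u (insert y (T' u)) u = insert y (T' u) :=
    Function.update_self _ _ _
  -- Enlarging `T' u` by `y` would give a family of larger total size.
  have hnew : G.IsLoadedFamily D W m M (Function.update T' u (insert y (T' u))) := by
    refine ⟨?_, ?_, ?_, ?_, ?_⟩
    · have key : ∀ v ∈ W, v ≠ u → Disjoint (insert y (T' u)) (T' v) := by
        intro v hv hvu
        rw [Finset.disjoint_insert_left]
        exact ⟨hyT v hv, hT'.disjoint hu hv hvu.symm⟩
      intro v hv w hw hvw
      simp only [Function.onFun]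
      by_cases hvu : v = u
      · subst hvu
        rw [heq, hne w hvw.symm]
        exact key w hw hvw.symm
      · by_cases hwu : w = u
        · subst hwu
          rw [heq, hne v hvu]
          exact (key v hv hvu).symm
        · rw [hne v hvu, hne w hwu]
          exact hT'.disjoint hv hw hvw
    · intro v hv
      by_cases hvu : v = u
      · subst hvu
        rw [heq]
        exact (hT'.loaded v hv).insert hx hxy hyu (Nat.one_le_iff_ne_zero.2 hy0)
      · rw [hne v hvu]
        exact hT'.loaded v hv
    · intro v hv
      by_cases hvu : v = u
      · subst hvu
        rw [heq]
        intro z hz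
        rcases Finset.mem_insert.1 hz with rfl | hz
        · exact Nat.one_le_iff_ne_zero.2 hy0
        · exact hT'.occupied v hv z hz
      · rw [hne v hvu]
        exact hT'.occupied v hv
    · intro v hv
      by_cases hvu : v = u
      · subst hvu
        rw [heq, Finset.card_insert_of_notMem hyu]
        exact (hT'.le_card v hv).trans (Nat.le_succ _)
      · rw [hne v hvu]
        exact hT'.le_card v hv
    · intro v hv
      by_cases hvu : v = u
      · subst hvu
        rw [heq, Finset.card_insert_of_notMem hyu]
        exact hcard
      · rw [hne v hvu]
        exact hT'.card_le v hv
  refine absurd (hmax _ hnew) (not_le.2 ?_)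
  refine Finset.sum_lt_sum (fun v _ => ?_) ⟨u, hu, ?_⟩
  · by_cases hvu : v = u
    · subst hvu
      rw [heq]
      exact Finset.card_le_card (Finset.subset_insert _ _)
    · rw [hne v hvu]
  · rw [heq, Finset.card_insert_of_notMem hyu]
    exact Nat.lt_succ_self _

/-- If no vertex can collect `K` pebbles, then no vertex lies in `K` of the closed neighbourhoods
of a loaded family, which bounds their total size. -/
lemma IsLoadedFamily.sum_card_closedNbhd_le {D : V → ℕ} {W : Finset V} {m M K : ℕ}
    {T : V → Finset V} (h : G.IsLoadedFamily D W m M T)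
    (hK : ∀ E, Relation.ReflTransGen G.PebblingStep D E → ∀ w, E w < K) :
    ∑ u ∈ W, (G.closedNbhd (T u)).card ≤ Fintype.card V * K := by
  classical
  have h1 : ∑ u ∈ W, (G.closedNbhd (T u)).card
      = ∑ w : V, (W.filter fun u => w ∈ G.closedNbhd (T u)).card := by
    have := Finset.sum_card_bipartiteAbove_eq_sum_card_bipartiteBelow (s := W)
      (t := (Finset.univ : Finset V)) (fun u w => w ∈ G.closedNbhd (T u))
    simpa [Finset.bipartiteAbove, Finset.bipartiteBelow] using this
  rw [h1, ← smul_eq_mul]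
  refine Finset.sum_le_card_nsmul _ _ _ fun w _ => ?_
  obtain ⟨E, hE, hEw⟩ := exists_card_le_of_isLoaded (G := G) (D := D) (w := w)
    (W.filter fun u => w ∈ G.closedNbhd (T u)) T
    (h.disjoint.subset fun u hu => (Finset.mem_filter.1 hu).1)
    (fun u hu => h.loaded u (Finset.mem_filter.1 hu).1)
    (fun u hu => (Finset.mem_filter.1 hu).2)
  exact hEw.trans (hK E hE w).le

/-! ### Expanding graphs -/

variable (G) in
/-- Vertex expansion: the closed neighbourhood of a nonempty set of `s` vertices has at least
`A * s` elements, or contains at least three quarters of all vertices. -/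
def IsExpanding (A : ℕ) : Prop :=
  ∀ S : Finset V, S.Nonempty →
    min (4 * (A * S.card)) (3 * Fintype.card V) ≤ 4 * (G.closedNbhd S).card

lemma exists_walk_of_mem_iterate_closedNbhd (v : V) (i : ℕ) :
    ∀ w ∈ (G.closedNbhd)^[i] {v}, ∃ q : G.Walk v w, q.length ≤ i := by
  induction i with
  | zero =>
    intro w hw
    rw [Function.iterate_zero, id, Finset.mem_singleton] at hw
    subst hw
    exact ⟨Walk.nil, le_rfl⟩
  | succ i ih =>
    intro w hw
    rw [Function.iterate_succ_apply', mem_closedNbhd] at hw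
    rcases hw with hw | ⟨x, hx, hxw⟩
    · obtain ⟨q, hq⟩ := ih w hw
      exact ⟨q, hq.trans (Nat.le_succ i)⟩
    · obtain ⟨q, hq⟩ := ih x hx
      exact ⟨q.concat hxw, by rw [Walk.length_concat]; omega⟩

lemma IsExpanding.le_card_iterate_closedNbhd {A : ℕ} (hG : G.IsExpanding A) (v : V) (i : ℕ) :
    min (4 * A ^ i) (3 * Fintype.card V) ≤ 4 * ((G.closedNbhd)^[i] {v}).card ∧
      ((G.closedNbhd)^[i] {v}).Nonempty := by
  induction i with
  | zero => simp
  | succ i ih =>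
    obtain ⟨ih, hne⟩ := ih
    rw [Function.iterate_succ_apply']
    refine ⟨?_, hne.mono (subset_closedNbhd _)⟩
    have h := hG _ hne
    set B := (G.closedNbhd)^[i] {v} with hB
    rcases min_le_iff.1 ih with h' | h'
    · refine le_trans (min_le_min_right _ ?_) h
      rw [pow_succ']
      have := Nat.mul_le_mul_left A h'
      nlinarith
    · refine (min_le_right _ _).trans (h'.trans ?_)
      exact Nat.mul_le_mul_left 4 (Finset.card_le_card (subset_closedNbhd _))

/-- Balls of radius `I` contain more than half of the vertices, so any two of them meet. -/
lemma IsExpanding.exists_walk {A I : ℕ} (hG : G.IsExpanding A)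
    (hI : Fintype.card V ≤ A ^ I) (v w : V) : ∃ q : G.Walk v w, q.length ≤ 2 * I := by
  have hpos : 0 < Fintype.card V := Fintype.card_pos_iff.2 ⟨v⟩
  have hcard : ∀ x : V, 3 * Fintype.card V ≤ 4 * ((G.closedNbhd)^[I] {x}).card := by
    intro x
    have := (hG.le_card_iterate_closedNbhd x I).1
    rcases min_le_iff.1 this with h | h <;> omega
  have hmeet : ∃ x, x ∈ (G.closedNbhd)^[I] {v} ∧ x ∈ (G.closedNbhd)^[I] {w} := by
    by_contra! hcon
    have hdisj : Disjoint ((G.closedNbhd)^[I] {v}) ((G.closedNbhd)^[I] {w}) :=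
      Finset.disjoint_left.2 hcon
    have h1 := Finset.card_le_univ ((G.closedNbhd)^[I] {v} ∪ (G.closedNbhd)^[I] {w})
    rw [Finset.card_union_of_disjoint hdisj] at h1
    have h2 := hcard v
    have h3 := hcard w
    omega
  obtain ⟨x, hxv, hxw⟩ := hmeet
  obtain ⟨q, hq⟩ := exists_walk_of_mem_iterate_closedNbhd v I x hxv
  obtain ⟨q', hq'⟩ := exists_walk_of_mem_iterate_closedNbhd w I x hxw
  refine ⟨q.append q'.reverse, ?_⟩
  rw [Walk.length_append, Walk.length_reverse]
  omega

/-! ### Collecting pebbles in expanding graphs -/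

/-- If `n` pebbles are placed with fewer than `K` on each vertex, the surplus on the vertices
with at least two pebbles pays for the empty vertices. -/
lemma card_filter_eq_zero_le {α : Type*} [Fintype α] {D : α → ℕ} {K : ℕ}
    (hD : ∑ v, D v = Fintype.card α)
    (hK : ∀ v, D v < K) :
    (Finset.univ.filter fun v => D v = 0).card
      ≤ K * (Finset.univ.filter fun v => 2 ≤ D v).card := by
  have h : ∑ v, (1 + K * if 2 ≤ D v then 1 else 0)
      ≥ ∑ v, (D v + if D v = 0 then 1 else 0) := by
    refine Finset.sum_le_sum fun v _ => ?_
    have := hK v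
    split_ifs <;> omega
  rw [Finset.sum_add_distrib, Finset.sum_add_distrib, hD, ← Finset.mul_sum, Finset.sum_boole,
    Finset.sum_boole] at h
  simp only [Finset.sum_const, Finset.card_univ, smul_eq_mul, mul_one, Nat.cast_id] at h
  omega

/-- When fewer than `A / 2` vertices are empty, a maximal loaded set reaches the neighbourhood of
every root: otherwise the empty vertices would separate it from the root. -/
lemma IsExpanding.pebblingSolvableAt_of_few_empty {A : ℕ} (hG : G.IsExpanding A) {D : V → ℕ}
    (hA : 2 * (Finset.univ.filter fun v => D v = 0).card < A) (hn : A ≤ Fintype.card V)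
    {u r : V} (hu : 2 ≤ D u) : G.PebblingSolvableAt D r := by
  by_contra hr
  have hr0 : D r = 0 := by
    by_contra h
    exact hr ⟨D, Relation.ReflTransGen.refl, Nat.one_le_iff_ne_zero.2 h⟩
  set Z := Finset.univ.filter fun v => D v = 0 with hZ
  have hrZ : r ∈ Z := by simp [hZ, hr0]
  have hZ1 : 1 ≤ Z.card := Finset.card_pos.2 ⟨r, hrZ⟩
  -- The size cap `|V| + 1` is never attained, so the maximal set is blocked by empty vertices only.
  obtain ⟨T', hT', hmax⟩ := (isLoadedFamily_singleton (G := G) (W := {u}) (D := D)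
    (M := Fintype.card V + 1) (by simpa using hu) (Nat.le_add_left _ _)).exists_maximal
  have huu := Finset.mem_singleton_self u
  have hN := hmax u huu (Nat.lt_succ_of_le (Finset.card_le_univ _))
  set T := T' u with hT
  have hTne : 1 ≤ T.card := hT'.le_card u huu
  have hrN : r ∉ G.closedNbhd T := by
    intro h
    obtain ⟨E, hE, hEr⟩ := (hT'.loaded u huu).exists_one_le h
    obtain ⟨E', hE', hle⟩ := reflTransGen_pebblingStep_of_le hE (pebblesOn_le D T)
    exact hr ⟨E', hE', hEr.trans (hle r)⟩
  have hNsub : G.closedNbhd T ⊆ T ∪ Z := by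
    intro y hy
    rcases hN y hy with h | ⟨v, hv, h⟩
    · exact Finset.mem_union_right _ (by simp [hZ, h])
    · rw [Finset.mem_singleton.1 hv] at h
      exact Finset.mem_union_left _ h
  have hNcard : (G.closedNbhd T).card ≤ T.card + Z.card :=
    (Finset.card_le_card hNsub).trans (Finset.card_union_le _ _)
  have h1 := hG T (Finset.card_pos.1 hTne)
  -- The far side of the separation: the root and all occupied vertices outside `T`.
  set S := insert r (T ∪ Z)ᶜ with hS
  have hScard : Fintype.card V + 1 ≤ S.card + (T.card + Z.card) := by
    rw [hS, Finset.card_insert_of_notMem (by simp [hrZ]), Finset.card_compl]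
    have := Finset.card_union_le T Z
    have := Finset.card_le_univ (T ∪ Z)
    omega
  have hSN : Disjoint (G.closedNbhd S) T := by
    rw [Finset.disjoint_left]
    intro y hy hyT
    have hST : ∀ x ∈ S, x ∉ G.closedNbhd T := by
      intro x hx
      rcases Finset.mem_insert.1 hx with rfl | hx
      · exact hrN
      · exact fun h => (Finset.mem_compl.1 hx) (hNsub h)
    rcases mem_closedNbhd.1 hy with h | ⟨x, hx, hxy⟩
    · exact hST y h (subset_closedNbhd T hyT)
    · exact hST x hx (mem_closedNbhd.2 (Or.inr ⟨y, hyT, hxy.symm⟩))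
  have hSNcard : (G.closedNbhd S).card + T.card ≤ Fintype.card V := by
    rw [← Finset.card_union_of_disjoint hSN]
    exact Finset.card_le_univ _
  have hSne : S.Nonempty := ⟨r, Finset.mem_insert_self _ _⟩
  have hS1 : 1 ≤ S.card := Finset.card_pos.2 hSne
  have h2 := hG S hSne
  have hmul : ∀ x : ℕ, 1 ≤ x → x + Z.card < A * x := by
    intro x hx
    have h3 : (2 * Z.card + 1) * x ≤ A * x := Nat.mul_le_mul_right x hA
    nlinarith
  have h3 := hmul _ hTne
  have h4 := hmul _ hS1
  rcases min_le_iff.1 h1 with h1 | h1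
  · omega
  · rcases min_le_iff.1 h2 with h2 | h2 <;> omega

/-- Growth of families of loaded sets. If no vertex can collect `K` pebbles, then a family of sets
of size `m` can be thinned to at least half of its members and these be enlarged to size `L * m`:
in a maximal enlargement, the closed neighbourhood of the members that stay small is covered by
the empty vertices and by the family, which contradicts expansion if they are a majority. -/
lemma IsExpanding.exists_isLoadedFamily_mul {A K L c m : ℕ} (hG : G.IsExpanding A) {D : V → ℕ}
    (hK : ∀ E, Relation.ReflTransGen G.PebblingStep D E → ∀ w, E w < K)
    (hA : 2 * K * (c + L) < A) (hL : 1 ≤ L) (hm : 1 ≤ m) {W : Finset V} (hWne : W.Nonempty)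
    (hW : 2 * K ≤ W.card)
    (hZ : (Finset.univ.filter fun v => D v = 0).card ≤ c * W.card) {T : V → Finset V}
    (hT : G.IsLoadedFamily D W m m T) :
    ∃ W' ⊆ W, ∃ T', W.card ≤ 2 * W'.card ∧ G.IsLoadedFamily D W' (L * m) (L * m) T' := by
  classical
  obtain ⟨v₀, _⟩ := hWne
  have hn : 0 < Fintype.card V := Fintype.card_pos_iff.2 ⟨v₀⟩
  have hK1 : 1 ≤ K := (Nat.zero_le _).trans_lt (hK D Relation.ReflTransGen.refl v₀)
  set n := Fintype.card V with hn_def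
  set Z := Finset.univ.filter fun v => D v = 0 with hZdef
  have hmL : m ≤ L * m := Nat.le_mul_of_pos_left m hL
  obtain ⟨T', hT', hmax⟩ := (IsLoadedFamily.mk hT.disjoint hT.loaded hT.occupied hT.le_card
    (fun u hu => (hT.card_le u hu).trans hmL) :
      G.IsLoadedFamily D W m (L * m) T).exists_maximal
  by_cases hhalf : W.card ≤ 2 * (W.filter fun u => (T' u).card = L * m).card
  · refine ⟨_, Finset.filter_subset _ W, T', hhalf, ?_⟩
    have hmem : ∀ u ∈ W.filter fun u => (T' u).card = L * m, u ∈ W :=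
      fun u hu => (Finset.mem_filter.1 hu).1
    exact ⟨hT'.disjoint.subset hmem, fun u hu => hT'.loaded u (hmem u hu),
      fun u hu => hT'.occupied u (hmem u hu), fun u hu => (Finset.mem_filter.1 hu).2.ge,
      fun u hu => (Finset.mem_filter.1 hu).2.le⟩
  exfalso
  set Q := W.filter fun u => ¬ (T' u).card = L * m with hQ
  have hQW : Q ⊆ W := Finset.filter_subset _ _
  have hQcard : W.card ≤ 2 * Q.card := by
    have : (W.filter fun u => (T' u).card = L * m).card + Q.card = W.card := by
      rw [hQ]
      convert Finset.card_filter_add_card_filter_not (s := W) fun u => (T' u).card = L * m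
    omega
  set B := Q.biUnion T' with hB
  have hBcard : Q.card * m ≤ B.card := by
    rw [hB, Finset.card_biUnion (fun x hx y hy hxy => hT'.disjoint (hQW hx) (hQW hy) hxy),
      ← smul_eq_mul]
    exact Finset.card_nsmul_le_sum _ _ _ fun u hu => hT'.le_card u (hQW hu)
  have hNB : G.closedNbhd B ⊆ Z ∪ W.biUnion T' := by
    intro y hy
    have : ∃ u ∈ Q, y ∈ G.closedNbhd (T' u) := by
      rcases mem_closedNbhd.1 hy with h | ⟨x, hx, hxy⟩
      · obtain ⟨u, hu, h⟩ := Finset.mem_biUnion.1 h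
        exact ⟨u, hu, subset_closedNbhd _ h⟩
      · obtain ⟨u, hu, h⟩ := Finset.mem_biUnion.1 hx
        exact ⟨u, hu, mem_closedNbhd.2 (Or.inr ⟨x, h, hxy⟩)⟩
    obtain ⟨u, hu, hyu⟩ := this
    have hlt : (T' u).card < L * m :=
      lt_of_le_of_ne (hT'.card_le u (hQW hu)) (Finset.mem_filter.1 hu).2
    rcases hmax u (hQW hu) hlt y hyu with h | ⟨v, hv, h⟩
    · exact Finset.mem_union_left _ (by simp [hZdef, h])
    · exact Finset.mem_union_right _ (Finset.mem_biUnion.2 ⟨v, hv, h⟩)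
  have hNBcard : (G.closedNbhd B).card ≤ W.card * m * (c + L) := by
    calc (G.closedNbhd B).card ≤ Z.card + W.card * (L * m) :=
          (Finset.card_le_card hNB).trans ((Finset.card_union_le _ _).trans
            (Nat.add_le_add_left (Finset.card_biUnion_le_card_mul _ _ _ hT'.card_le) _))
      _ ≤ c * W.card * m + W.card * (L * m) :=
          Nat.add_le_add_right (hZ.trans (Nat.le_mul_of_pos_right _ hm)) _
      _ = W.card * m * (c + L) := by ring
  have hQpos : 1 ≤ Q.card := by omega
  have hBne : B.Nonempty := Finset.card_pos.1 (lt_of_lt_of_le (Nat.mul_pos hQpos hm) hBcard)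
  have hWm : 0 < W.card * m := Nat.mul_pos (by omega) hm
  rcases min_le_iff.1 (hG B hBne) with h | h
  · have h1 : A * (W.card * m) ≤ 2 * (A * B.card) := by
      have := Nat.mul_le_mul_left A hBcard
      have h2 : A * (W.card * m) ≤ A * (2 * Q.card * m) := by gcongr
      nlinarith
    have h2 : A * (W.card * m) ≤ (2 * (c + L)) * (W.card * m) := by nlinarith
    have h3 := Nat.le_of_mul_le_mul_right h2 hWm
    nlinarith
  · have hsum := hT.sum_card_closedNbhd_le hK
    have hlow : W.card * min (4 * (A * m)) (3 * n) ≤ 4 * (n * K) := by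
      refine le_trans ?_ (Nat.mul_le_mul_left 4 hsum)
      rw [Finset.mul_sum, ← smul_eq_mul]
      refine Finset.card_nsmul_le_sum _ _ _ fun u hu => ?_
      have hcu : (T u).card = m := le_antisymm (hT.card_le u hu) (hT.le_card u hu)
      have := hG (T u) (Finset.card_pos.1 (by omega))
      rwa [hcu] at this
    rcases min_choice (4 * (A * m)) (3 * n) with h' | h'
    · rw [h'] at hlow
      have h1 : A * (W.card * m) ≤ n * K := by nlinarith
      have h2 : 3 * (A * (W.card * m)) ≤ (4 * (K * (c + L))) * (W.card * m) := by nlinarith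
      have h3 : 3 * A ≤ 4 * (K * (c + L)) := by
        refine Nat.le_of_mul_le_mul_right ?_ hWm
        rw [mul_assoc]
        exact h2
      nlinarith
    · rw [h'] at hlow
      have h1 : 2 * K * (3 * n) ≤ 4 * (n * K) := (Nat.mul_le_mul_right _ hW).trans hlow
      have h2 : 0 < n * K := Nat.mul_pos hn hK1
      nlinarith

/-- In a strongly expanding graph every distribution of `|V|` pebbles is solvable. -/
theorem IsExpanding.pebblingSolvable {A I L : ℕ} (hG : G.IsExpanding A) (hL : 2 ≤ L)
    (hI : Fintype.card V < L ^ I) (hA : 4 * 32 ^ I * L ≤ A) (hn : A ≤ Fintype.card V)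
    {D : V → ℕ} (hD : ∑ v, D v = Fintype.card V) : G.PebblingSolvable D := by
  intro r
  by_contra hr
  have h32 : 1 ≤ 32 ^ I := Nat.one_le_pow _ _ (by norm_num)
  have hLA : L ≤ A := by nlinarith
  have hAI : Fintype.card V ≤ A ^ I := hI.le.trans (Nat.pow_le_pow_left hLA I)
  -- Every vertex is within distance `2 * I` of the root, so `4 ^ I` pebbles suffice there.
  have hK : ∀ E, Relation.ReflTransGen G.PebblingStep D E → ∀ w, E w < 4 ^ I := by
    intro E hE w
    by_contra! h
    obtain ⟨q, hq⟩ := hG.exists_walk hAI w r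
    refine hr (q.pebblingSolvableAt hE (le_trans ?_ h))
    calc 2 ^ q.length ≤ 2 ^ (2 * I) := Nat.pow_le_pow_right (by norm_num) hq
      _ = 4 ^ I := by rw [pow_mul]; norm_num
  set Z := Finset.univ.filter fun v => D v = 0 with hZ
  set U := Finset.univ.filter fun v => 2 ≤ D v with hU
  have hZU : Z.card ≤ 4 ^ I * U.card :=
    card_filter_eq_zero_le hD fun v => hK D Relation.ReflTransGen.refl v
  have hrZ : r ∈ Z := by
    rw [hZ, Finset.mem_filter]
    refine ⟨Finset.mem_univ _, ?_⟩
    by_contra h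
    exact hr ⟨D, Relation.ReflTransGen.refl, Nat.one_le_iff_ne_zero.2 h⟩
  have hZpos : 0 < Z.card := Finset.card_pos.2 ⟨r, hrZ⟩
  have hUpos : 0 < U.card := by
    by_contra! h
    rw [Nat.le_zero.1 h] at hZU
    omega
  rcases lt_or_ge (2 * Z.card) A with hZA | hZA
  · obtain ⟨u, hu⟩ := Finset.card_pos.1 hUpos
    exact hr (hG.pebblingSolvableAt_of_few_empty hZA hn (by simpa [hU] using hu))
  have hKpos : 0 < 4 ^ I := by positivity
  have h2pos : 0 < 2 ^ I := by positivity
  have h32eq : 32 ^ I = 4 ^ I * 4 ^ I * 2 ^ I := by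
    rw [← mul_pow, ← mul_pow]
    norm_num
  have hgrow : ∀ i ≤ I, ∃ W T,
      U.card ≤ 2 ^ i * W.card ∧ G.IsLoadedFamily D W (L ^ i) (L ^ i) T := by
    intro i
    induction i with
    | zero =>
      intro _
      exact ⟨U, fun u => {u}, by simp,
        isLoadedFamily_singleton (by simp [hU]) (by simp)⟩
    | succ i ih =>
      intro hi
      obtain ⟨W, T, hW, hT⟩ := ih (by omega)
      have h2i : 2 ^ i ≤ 2 ^ I := Nat.pow_le_pow_right (by norm_num) (by omega)
      have hWU : U.card ≤ 2 ^ I * W.card := hW.trans (Nat.mul_le_mul_right _ h2i)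
      have hZW : Z.card ≤ 4 ^ I * 2 ^ I * W.card := by
        rw [mul_assoc]
        exact hZU.trans (Nat.mul_le_mul_left _ hWU)
      have hWpos : 0 < W.card := by
        by_contra! h
        rw [Nat.le_zero.1 h] at hWU
        omega
      have hWK : 2 * 4 ^ I ≤ W.card := by
        have h1 : 4 * (4 ^ I * 4 ^ I * 2 ^ I) * 1 ≤ 2 * (4 ^ I * 2 ^ I * W.card) := by
          rw [← h32eq]
          calc 4 * 32 ^ I * 1 ≤ 4 * 32 ^ I * L := Nat.mul_le_mul_left _ (by omega)
            _ ≤ A := hA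
            _ ≤ 2 * Z.card := hZA
            _ ≤ _ := Nat.mul_le_mul_left 2 hZW
        refine Nat.le_of_mul_le_mul_left ?_ (Nat.mul_pos hKpos h2pos)
        nlinarith
      have hAc : 2 * 4 ^ I * (4 ^ I * 2 ^ I + L) < A := by
        refine lt_of_lt_of_le ?_ hA
        rw [h32eq]
        have h1 : 4 ^ I * L ≤ 4 ^ I * 4 ^ I * 2 ^ I * L := by
          refine Nat.mul_le_mul_right L ?_
          rw [mul_assoc]
          exact Nat.le_mul_of_pos_right _ (Nat.mul_pos hKpos h2pos)
        have h2 : 4 ^ I * 4 ^ I * 2 ^ I * 2 ≤ 4 ^ I * 4 ^ I * 2 ^ I * L :=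
          Nat.mul_le_mul_left _ hL
        have h3 : 0 < 4 ^ I * 4 ^ I * 2 ^ I := by positivity
        nlinarith
      obtain ⟨W', _, T', hW', hT'⟩ := hG.exists_isLoadedFamily_mul hK hAc (by omega)
        (Nat.one_le_pow _ _ (by omega)) (Finset.card_pos.1 hWpos) hWK hZW hT
      refine ⟨W', T', ?_, by rwa [pow_succ']⟩
      calc U.card ≤ 2 ^ i * W.card := hW
        _ ≤ 2 ^ i * (2 * W'.card) := Nat.mul_le_mul_left _ hW'
        _ = 2 ^ (i + 1) * W'.card := by ring
  obtain ⟨W, T, hW, hT⟩ := hgrow I le_rfl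
  have hWne : W.Nonempty := by
    rw [Finset.nonempty_iff_ne_empty]
    rintro rfl
    simp only [Finset.card_empty, mul_zero] at hW
    omega
  obtain ⟨u, hu⟩ := hWne
  have h1 := hT.le_card u hu
  have h2 := Finset.card_le_univ (T u)
  omega

/-! ### Bounds for the pebbling number -/

lemma le_pebblingNumber : (Fintype.card V : ℕ∞) ≤ G.pebblingNumber := by
  refine le_iInf₂ fun t ht => ?_
  rw [Nat.cast_le]
  by_contra! hlt
  obtain ⟨r⟩ : Nonempty V := Fintype.card_pos_iff.1 (by omega)
  obtain ⟨S, hS, hcard⟩ := Finset.exists_subset_card_eq (s := Finset.univ.erase r) (n := t)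
    (by rw [Finset.card_erase_of_mem (Finset.mem_univ r), Finset.card_univ]; omega)
  -- One pebble on each of `t` vertices other than `r` allows no step at all.
  obtain ⟨D', hD', hr⟩ := ht (fun v => if v ∈ S then 1 else 0) (by simp [hcard]) r
  rcases hD'.cases_head with rfl | ⟨E, ⟨u, v, F, _, hF, _⟩, _⟩
  · have : r ∉ S := fun h => (Finset.mem_erase.1 (hS h)).1 rfl
    simp [this] at hr
  · have h := congrFun hF u
    simp only [Pi.add_apply, Pi.single_eq_same] at h
    split_ifs at h
    omega

theorem IsExpanding.isClassZero {A I L : ℕ} (hG : G.IsExpanding A) (hL : 2 ≤ L)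
    (hI : Fintype.card V < L ^ I) (hA : 4 * 32 ^ I * L ≤ A) (hn : A ≤ Fintype.card V) :
    G.IsClassZero :=
  le_antisymm (iInf₂_le _ fun _ hD => hG.pebblingSolvable hL hI hA hn hD) le_pebblingNumber

/-- A vertex without neighbours cannot receive a pebble. -/
lemma not_isClassZero_of_isolated [Nontrivial V] {v : V} (hv : ∀ w, ¬ G.Adj v w) :
    ¬ G.IsClassZero := by
  intro h
  obtain ⟨w, hw⟩ := exists_ne v
  have htop : G.pebblingNumber = ⊤ := by
    refine iInf₂_eq_top.2 fun t ht => absurd (ht (Pi.single w t) (by simp)) fun hsol => ?_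
    have hzero : ∀ E, Relation.ReflTransGen G.PebblingStep (Pi.single w t) E → E v = 0 := by
      intro E hE
      induction hE with
      | refl => simp [hw.symm]
      | tail _ hstep ih =>
        obtain ⟨a, b, E, hab, rfl, rfl⟩ := hstep
        have hvb : v ≠ b := by
          rintro rfl
          exact hv a hab.symm
        have h0 : E v = 0 := (Nat.add_eq_zero_iff.1 ih).1
        simp [h0, hvb]
    obtain ⟨D', hD', hv1⟩ := hsol v
    have := hzero D' hD'
    omega
  rw [IsClassZero, htop] at h
  exact ENat.natCast_ne_top _ h.symm

open MeasureTheory ProbabilityTheory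

/-! ### Events of the binomial random graph -/

instance discreteMeasurableSpace {V : Type*} [Finite V] :
    DiscreteMeasurableSpace (SimpleGraph V) where
  forall_measurableSet s := by
    rw [← Set.preimage_image_eq s edgeSet_injective]
    exact measurable_edgeSet .of_discrete

lemma binomialRandom_real_forall_notMem {V : Type*} [Finite V] (p : unitInterval)
    (F : Finset (Sym2 V))    (hF : ∀ e ∈ F, ¬ e.IsDiag) :
    (binomialRandom V p).real {G | ∀ e ∈ F, e ∉ G.edgeSet} = (1 - p : ℝ) ^ F.card := by
  have hpre : (fun q : Sym2 V → Prop => {i | q i}) ⁻¹'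
      (fromEdgeSet ⁻¹' {G | ∀ e ∈ F, e ∉ G.edgeSet}) = Set.pi F fun _ => {False} := by
    ext q
    simp only [edgeSet_fromEdgeSet, Set.mem_preimage, Set.mem_ofPred_eq, Set.mem_sdiff,
      Set.mem_pi, SetLike.mem_coe, Set.mem_singleton_iff, eq_iff_iff, iff_false]
    refine forall₂_congr fun e he => ?_
    simp [hF e he]
  have h1 : binomialRandom V p {G | ∀ e ∈ F, e ∉ G.edgeSet}
      = (unitInterval.toNNReal (unitInterval.symm p) : ENNReal) ^ F.card := by
    rw [binomialRandom_eq_map, Measure.map_apply measurable_fromEdgeSet .of_discrete,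
      setBernoulli_apply', hpre, Measure.infinitePi_pi _ fun _ _ => .of_discrete,
      ← Finset.prod_const]
    refine Finset.prod_congr rfl fun e he => ?_
    simp [hF e he]
  rw [measureReal_def, h1]
  simp

lemma binomialRandom_real_forall_not_adj {V : Type*} [Finite V] [DecidableEq V] (p : unitInterval)
    {S W : Finset V} (hSW : Disjoint S W) :
    (binomialRandom V p).real {G | ∀ v ∈ S, ∀ w ∈ W, ¬ G.Adj v w}
      = (1 - p : ℝ) ^ (S.card * W.card) := by
  have hne : ∀ x ∈ S, ∀ y ∈ W, x ≠ y := fun x hx y hy h =>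
    Finset.disjoint_left.1 hSW hx (h ▸ hy)
  have hinj : Set.InjOn (fun x : V × V => s(x.1, x.2)) (S ×ˢ W : Finset (V × V)) := by
    rintro ⟨a, b⟩ hab ⟨c, d⟩ hcd h
    simp only [Finset.coe_product, Set.mem_prod, Finset.mem_coe] at hab hcd
    rcases Sym2.eq_iff.1 h with ⟨h1, h2⟩ | ⟨h1, h2⟩
    · exact Prod.ext h1 h2
    · exact absurd h1 (hne a hab.1 d hcd.2)
  rw [← Finset.card_product, ← Finset.card_image_of_injOn hinj,
    ← binomialRandom_real_forall_notMem]
  · congr 1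
    ext G
    simp only [Set.mem_ofPred_eq, Finset.mem_image, Finset.mem_product, Prod.exists]
    constructor
    · rintro h e ⟨a, b, ⟨ha, hb⟩, rfl⟩
      exact h a ha b hb
    · intro h v hv w hw
      exact h _ ⟨v, w, ⟨hv, hw⟩, rfl⟩
  · intro e he
    obtain ⟨⟨a, b⟩, hab, rfl⟩ := Finset.mem_image.1 he
    rw [Finset.mem_product] at hab
    exact hne a hab.1 b hab.2

/-! ### Expansion of random graphs -/

lemma exists_image_univ_eq {V : Type*} [DecidableEq V] {T : Finset V} (hT : T.Nonempty) {k : ℕ}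
    (hk : T.card ≤ k) : ∃ f : Fin k → V, Finset.univ.image f = T := by
  obtain ⟨φ⟩ : Nonempty (T ↪ Fin k) := Function.Embedding.nonempty_of_card_le (by simpa using hk)
  have : Nonempty T := hT.to_subtype
  have hsurj := Function.invFun_surjective (f := (φ : T → Fin k)) φ.injective
  refine ⟨fun i => ((Function.invFun (φ : T → Fin k) i : T) : V), ?_⟩
  ext v
  simp only [Finset.mem_image, Finset.mem_univ, true_and]
  constructor
  · rintro ⟨i, rfl⟩
    exact (Function.invFun (φ : T → Fin k) i).2
  · intro hv
    obtain ⟨i, hi⟩ := hsurj ⟨v, hv⟩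
    exact ⟨i, by rw [hi]⟩

/-- Union bound over the sets `S` violating expansion and their closed neighbourhoods, listed as
the ranges of functions `f` and `g`: there are `n ^ ((A + 1) * s)` such pairs with `|S| = s`, and
each is bad with probability at most `exp (-p * s * n / 4)`. -/
theorem binomialRandom_real_not_isExpanding_le {V : Type*} [Fintype V] [DecidableEq V]
    (p : unitInterval)
    {A : ℕ} (hV : 1 ≤ Fintype.card V)
    (hp : (A + 3) * Real.log (Fintype.card V) ≤ p * Fintype.card V / 4) :
    (binomialRandom V p).real {G | ¬ G.IsExpanding A} ≤ 1 / Fintype.card V := by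
  classical
  set n := Fintype.card V with hn
  have hn0 : (0 : ℝ) < n := by exact_mod_cast hV
  have hlog : 0 ≤ Real.log n := Real.log_nonneg (by exact_mod_cast hV)
  let bad : (s : ℕ) → (Fin s → V) × (Fin (A * s) → V) → Set (SimpleGraph V) := fun s fg =>
    {G | (Finset.univ.image fg.1).card = s ∧ 4 * (Finset.univ.image fg.2).card ≤ 3 * n ∧
      Finset.univ.image fg.1 ⊆ Finset.univ.image fg.2 ∧
      ∀ v ∈ Finset.univ.image fg.1, ∀ w ∈ (Finset.univ.image fg.2)ᶜ, ¬ G.Adj v w}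
  have hcover : {G : SimpleGraph V | ¬ G.IsExpanding A}
      ⊆ ⋃ s ∈ Finset.Icc 1 n, ⋃ fg ∈ Finset.univ, bad s fg := by
    intro G hG
    simp only [Set.mem_ofPred_eq, IsExpanding, not_forall, not_le, lt_min_iff] at hG
    obtain ⟨S, hS, h1, h2⟩ := hG
    obtain ⟨f, hf⟩ := exists_image_univ_eq hS le_rfl
    obtain ⟨g, hg⟩ := exists_image_univ_eq (hS.mono (subset_closedNbhd (G := G) S))
      (k := A * S.card) (by omega)
    simp only [Set.mem_iUnion]
    refine ⟨S.card, Finset.mem_Icc.2 ⟨Finset.card_pos.2 hS, Finset.card_le_univ S⟩, (f, g),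
      Finset.mem_univ _, ?_⟩
    simp only [bad, Set.mem_ofPred_eq, hf, hg]
    refine ⟨trivial, h2.le, subset_closedNbhd S, fun v hv w hw hvw => ?_⟩
    exact Finset.mem_compl.1 hw (mem_closedNbhd.2 (Or.inr ⟨v, hv, hvw⟩))
  have hbad : ∀ s fg, (binomialRandom V p).real (bad s fg)
      ≤ Real.exp (-(s * (p * n / 4))) := by
    intro s fg
    by_cases h : (Finset.univ.image fg.1).card = s ∧ 4 * (Finset.univ.image fg.2).card ≤ 3 * n ∧
      Finset.univ.image fg.1 ⊆ Finset.univ.image fg.2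
    · obtain ⟨h1, h2, h3⟩ := h
      have hdisj : Disjoint (Finset.univ.image fg.1) (Finset.univ.image fg.2)ᶜ :=
        disjoint_compl_right.mono_left h3
      have hcard : (n : ℝ) / 4 ≤ ((Finset.univ.image fg.2)ᶜ.card : ℝ) := by
        have : n ≤ 4 * (Finset.univ.image fg.2)ᶜ.card := by
          rw [Finset.card_compl]
          omega
        have : (n : ℝ) ≤ 4 * ((Finset.univ.image fg.2)ᶜ.card : ℝ) := by exact_mod_cast this
        linarith
      calc (binomialRandom V p).real (bad s fg)
          ≤ (binomialRandom V p).real {G | ∀ v ∈ Finset.univ.image fg.1,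
              ∀ w ∈ (Finset.univ.image fg.2)ᶜ, ¬ G.Adj v w} :=
            measureReal_mono fun G hG => hG.2.2.2
        _ = (1 - p : ℝ) ^ (s * (Finset.univ.image fg.2)ᶜ.card) := by
            rw [binomialRandom_real_forall_not_adj p hdisj, h1]
        _ ≤ Real.exp (-p) ^ (s * (Finset.univ.image fg.2)ᶜ.card) :=
            pow_le_pow_left₀ (by linarith [p.2.2]) (Real.one_sub_le_exp_neg _) _
        _ ≤ Real.exp (-(s * (p * n / 4))) := by
            rw [← Real.exp_nat_mul, Real.exp_le_exp]
            push_cast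
            have := mul_le_mul_of_nonneg_left hcard
              (mul_nonneg (Nat.cast_nonneg (α := ℝ) s) p.2.1)
            linarith
    · have : bad s fg = ∅ := by
        ext G
        simp only [bad, Set.mem_ofPred_eq, Set.mem_empty_iff_false, iff_false]
        rintro ⟨h1, h2, h3, _⟩
        exact h ⟨h1, h2, h3⟩
      rw [this, measureReal_empty]
      exact (Real.exp_pos _).le
  have hcount : ∀ s, ((Finset.univ : Finset ((Fin s → V) × (Fin (A * s) → V))).card : ℝ)
      = Real.exp (s * ((A + 1) * Real.log n)) := by
    intro s
    rw [Finset.card_univ, Fintype.card_prod, Fintype.card_fun, Fintype.card_fun, Fintype.card_fin,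
      Fintype.card_fin, ← hn, ← pow_add, Nat.cast_pow, ← Real.exp_log hn0, ← Real.exp_nat_mul,
      Real.exp_log hn0]
    push_cast
    ring_nf
  have hlevel : ∀ s ∈ Finset.Icc 1 n,
      (binomialRandom V p).real (⋃ fg ∈ Finset.univ, bad s fg) ≤ 1 / (n : ℝ) ^ 2 := by
    intro s hs
    have hs1 : (1 : ℝ) ≤ s := by exact_mod_cast (Finset.mem_Icc.1 hs).1
    calc (binomialRandom V p).real (⋃ fg ∈ Finset.univ, bad s fg)
        ≤ ∑ fg, (binomialRandom V p).real (bad s fg) := measureReal_biUnion_finset_le _ _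
      _ ≤ (Finset.univ : Finset ((Fin s → V) × (Fin (A * s) → V))).card
            • Real.exp (-(s * (p * n / 4))) :=
          Finset.sum_le_card_nsmul _ _ _ fun fg _ => hbad s fg
      _ = Real.exp (s * ((A + 1) * Real.log n - p * n / 4)) := by
          rw [nsmul_eq_mul, hcount, ← Real.exp_add]
          ring_nf
      _ ≤ Real.exp (-(2 * Real.log n)) := by
          rw [Real.exp_le_exp]
          have h1 : (A + 1) * Real.log n - p * n / 4 ≤ -(2 * Real.log n) := by linarith
          nlinarith [mul_le_mul_of_nonneg_left h1 (by linarith : (0 : ℝ) ≤ s)]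
      _ = 1 / (n : ℝ) ^ 2 := by
          rw [Real.exp_neg, two_mul, Real.exp_add, Real.exp_log hn0, sq, one_div]
  calc (binomialRandom V p).real {G | ¬ G.IsExpanding A}
      ≤ (binomialRandom V p).real (⋃ s ∈ Finset.Icc 1 n, ⋃ fg ∈ Finset.univ, bad s fg) :=
        measureReal_mono hcover (measure_ne_top _ _)
    _ ≤ ∑ s ∈ Finset.Icc 1 n, (binomialRandom V p).real (⋃ fg ∈ Finset.univ, bad s fg) :=
        measureReal_biUnion_finset_le _ _
    _ ≤ (Finset.Icc 1 n).card • (1 / (n : ℝ) ^ 2) := Finset.sum_le_card_nsmul _ _ _ hlevel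
    _ = 1 / n := by
        rw [Nat.card_Icc, nsmul_eq_mul, Nat.add_sub_cancel]
        field_simp

/-! ### Isolated vertices of random graphs -/

/-- The second moment method: Chebyshev's inequality for the number of events that occur. -/
lemma sq_sum_mul_measureReal_le {Ω ι : Type*} [MeasurableSpace Ω] {μ : Measure Ω}
    [IsProbabilityMeasure μ] [Fintype ι] {A : ι → Set Ω} (hA : ∀ i, MeasurableSet (A i)) :
    (∑ i, μ.real (A i)) ^ 2 * μ.real {ω | ∀ i, ω ∉ A i}
      ≤ ∑ i, ∑ j, μ.real (A i ∩ A j) - (∑ i, μ.real (A i)) ^ 2 := by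
  set a := ∑ i, μ.real (A i) with ha
  set X : Ω → ℝ := fun ω => ∑ i, (A i).indicator 1 ω with hX
  have hint : ∀ s : Set Ω, MeasurableSet s → Integrable (s.indicator (1 : Ω → ℝ)) μ :=
    fun s hs => (integrable_const (1 : ℝ)).indicator hs
  have hXint : Integrable X μ := integrable_finsetSum _ fun i _ => hint _ (hA i)
  have hXX : (fun ω => X ω ^ 2) = fun ω => ∑ i, ∑ j, (A i ∩ A j).indicator (1 : Ω → ℝ) ω := by
    funext ω
    simp only [hX, sq, Finset.sum_mul_sum, Set.inter_indicator_one, Pi.mul_apply]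
  have hXXint : Integrable (fun ω => X ω ^ 2) μ := by
    rw [hXX]
    exact integrable_finsetSum _ fun i _ => integrable_finsetSum _ fun j _ =>
      hint _ ((hA i).inter (hA j))
  have hEX : ∫ ω, X ω ∂μ = a := by
    rw [hX, integral_finsetSum _ fun i _ => hint _ (hA i)]
    exact Finset.sum_congr rfl fun i _ => integral_indicator_one (hA i)
  have hEXX : ∫ ω, X ω ^ 2 ∂μ = ∑ i, ∑ j, μ.real (A i ∩ A j) := by
    rw [hXX, integral_finsetSum _ fun i _ => integrable_finsetSum _ fun j _ =>
      hint _ ((hA i).inter (hA j))]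
    refine Finset.sum_congr rfl fun i _ => ?_
    rw [integral_finsetSum _ fun j _ => hint _ ((hA i).inter (hA j))]
    exact Finset.sum_congr rfl fun j _ => integral_indicator_one ((hA i).inter (hA j))
  have hB : MeasurableSet {ω | ∀ i, ω ∉ A i} := by
    rw [Set.ofPred_forall]
    exact MeasurableSet.iInter fun i => (hA i).compl
  have hle : ∫ ω, a ^ 2 * ({ω | ∀ i, ω ∉ A i}.indicator (1 : Ω → ℝ) ω) ∂μ
      ≤ ∫ ω, (X ω ^ 2 - 2 * a * X ω + a ^ 2) ∂μ := by
    refine integral_mono ((hint _ hB).const_mul _)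
      ((hXXint.sub (hXint.const_mul _)).add (integrable_const _)) fun ω => ?_
    by_cases hω : ω ∈ {ω | ∀ i, ω ∉ A i}
    · have : X ω = 0 := Finset.sum_eq_zero fun i _ => Set.indicator_of_notMem (hω i) _
      simp [hω, this]
    · simp only [Set.indicator_of_notMem hω, mul_zero]
      nlinarith [sq_nonneg (X ω - a)]
  have hrhs : ∫ ω, (X ω ^ 2 - 2 * a * X ω + a ^ 2) ∂μ
      = ∑ i, ∑ j, μ.real (A i ∩ A j) - 2 * a * a + a ^ 2 := by
    have h1 : Integrable (fun ω => X ω ^ 2 - 2 * a * X ω) μ := hXXint.sub (hXint.const_mul _)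
    rw [integral_add h1 (integrable_const _), integral_sub hXXint (hXint.const_mul _),
      integral_const_mul, hEX, hEXX]
    simp
  rw [integral_const_mul, integral_indicator_one hB, hrhs] at hle
  linarith

lemma binomialRandom_real_no_isolated_le {V : Type*} [Fintype V] [DecidableEq V] (p : unitInterval)
    (hp : (p : ℝ) < 1) (hV : 2 ≤ Fintype.card V) :
    (binomialRandom V p).real {G | ∀ v, ∃ w, G.Adj v w}
      ≤ 1 / (Fintype.card V * (1 - p : ℝ) ^ (Fintype.card V - 1)) + (1 / (1 - p : ℝ) ^ 2 - 1) := by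
  set n := Fintype.card V with hn
  set q : ℝ := 1 - p with hq
  have hq0 : 0 < q := by linarith
  have hn0 : (0 : ℝ) < n := by
    have : 0 < n := by omega
    exact_mod_cast this
  set A : V → Set (SimpleGraph V) := fun v =>
    {G | ∀ x ∈ ({v} : Finset V), ∀ w ∈ ({v} : Finset V)ᶜ, ¬ G.Adj x w} with hA
  have h1 : ∀ v, (binomialRandom V p).real (A v) = q ^ (n - 1) := by
    intro v
    rw [hA, binomialRandom_real_forall_not_adj p disjoint_compl_right, Finset.card_compl,
      Finset.card_singleton, one_mul]
  have h2 : ∀ v w, v ≠ w → (binomialRandom V p).real (A v ∩ A w) ≤ q ^ (2 * (n - 2)) := by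
    intro v w hvw
    have : (binomialRandom V p).real {G | ∀ x ∈ ({v, w} : Finset V),
        ∀ y ∈ ({v, w} : Finset V)ᶜ, ¬ G.Adj x y} = q ^ (2 * (n - 2)) := by
      rw [binomialRandom_real_forall_not_adj p disjoint_compl_right, Finset.card_compl,
        Finset.card_pair hvw]
    rw [← this]
    refine measureReal_mono ?_
    rintro G ⟨hGv, hGw⟩ x hx y hy
    simp only [Finset.mem_compl, Finset.mem_insert, Finset.mem_singleton, not_or] at hx hy
    rcases hx with rfl | rfl
    · exact hGv x (by simp) y (by simpa using hy.1)
    · exact hGw x (by simp) y (by simpa using hy.2)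
  have hset : {G : SimpleGraph V | ∀ v, ∃ w, G.Adj v w} ⊆ {G | ∀ v, G ∉ A v} := by
    intro G hG v hv
    obtain ⟨w, hw⟩ := hG v
    exact hv v (by simp) w (by simpa using hw.ne') hw
  have key := sq_sum_mul_measureReal_le (μ := binomialRandom V p) (A := A)
    (fun _ => .of_discrete)
  simp only [h1, Finset.sum_const, Finset.card_univ, nsmul_eq_mul, ← hn] at key
  have hsum : ∑ v, ∑ w, (binomialRandom V p).real (A v ∩ A w)
      ≤ n * q ^ (n - 1) + n * n * q ^ (2 * (n - 2)) := by
    have : ∀ v w, (binomialRandom V p).real (A v ∩ A w)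
        ≤ (if v = w then q ^ (n - 1) else 0) + q ^ (2 * (n - 2)) := by
      intro v w
      by_cases hvw : v = w
      · subst hvw
        rw [Set.inter_self, h1, if_pos rfl]
        exact le_add_of_nonneg_right (by positivity)
      · rw [if_neg hvw, zero_add]
        exact h2 v w hvw
    refine (Finset.sum_le_sum fun v _ => Finset.sum_le_sum fun w _ => this v w).trans ?_
    simp [Finset.sum_add_distrib, ← hn, mul_assoc]
  have hpow : q ^ (2 * (n - 2)) * q ^ 2 = (q ^ (n - 1)) ^ 2 := by
    rw [← pow_add, ← pow_mul]
    congr 1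
    omega
  set b := q ^ (n - 1) with hb
  have hb0 : 0 < b := by positivity
  have hnb : 0 < (n * b) ^ 2 := by positivity
  refine (measureReal_mono hset).trans ?_
  refine le_of_mul_le_mul_left (key.trans ?_) hnb
  have hexp : (n * b) ^ 2 * (1 / (n * b) + (1 / q ^ 2 - 1))
      = n * b + n * n * q ^ (2 * (n - 2)) - (n * b) ^ 2 := by
    have : n * n * q ^ (2 * (n - 2)) = (n * b) ^ 2 * (1 / q ^ 2) := by
      rw [mul_pow, ← hpow]
      field_simp
    rw [this]
    field_simp
    ring
  rw [hexp]
  linarith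

/-! ### The two regimes -/

/-- In the dense regime the random graph expands by a power of `n`: with `β = 1 / (2 * ⌈d⌉)`,
the hypothesis gives `p * n ≥ n ^ (2 * β)`, so `L = ⌈n ^ β⌉` may be taken, for which the bounded
number `I = 2 * ⌈d⌉ + 1` of growth rounds suffices. -/
lemma tendsto_binomialRandom_real_isClassZero (p : ℕ → unitInterval) {d : ℝ} (hd : 0 < d)
    (h : Filter.Tendsto
        (fun n : ℕ => ((p n : ℝ) * (n : ℝ)) / ((n : ℝ) * Real.log (n : ℝ)) ^ (1 / d))
        Filter.atTop Filter.atTop) :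
    Filter.Tendsto
      (fun n : ℕ => (binomialRandom (Fin n) (p n)).real {G | G.IsClassZero})
      Filter.atTop (nhds 1) := by
  set k := ⌈d⌉₊ with hk
  have hk1 : 0 < k := Nat.ceil_pos.2 hd
  have hdk : d ≤ k := Nat.le_ceil d
  have hk0 : (0 : ℝ) < k := by exact_mod_cast hk1
  set β : ℝ := 1 / (2 * k) with hβ
  have hβ0 : 0 < β := by positivity
  set c : ℕ := 4 * 32 ^ (2 * k + 1) with hc
  have hev : ∀ᶠ n : ℕ in Filter.atTop,
      1 - 1 / (n : ℝ) ≤ (binomialRandom (Fin n) (p n)).real {G | G.IsClassZero} := by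
    have hlog1 : ∀ᶠ n : ℕ in Filter.atTop, 1 ≤ Real.log n :=
      (Real.tendsto_log_atTop.comp tendsto_natCast_atTop_atTop).eventually_ge_atTop 1
    have hε : (0 : ℝ) < 1 / (4 * (2 * c + 3)) := by positivity
    have hlogβ : ∀ᶠ n : ℕ in Filter.atTop,
        Real.log n ≤ 1 / (4 * (2 * c + 3)) * (n : ℝ) ^ β := by
      have := tendsto_natCast_atTop_atTop.eventually
        ((isLittleO_log_rpow_atTop hβ0).bound hε)
      filter_upwards [this, hlog1] with n hn h1
      rwa [Real.norm_of_nonneg (by linarith), Real.norm_of_nonneg (by positivity)] at hn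
    filter_upwards [h.eventually_ge_atTop 1, hlog1, hlogβ, Filter.eventually_ge_atTop 2]
      with n hpn hlog hlogβ hn2
    have hn0 : (0 : ℝ) < n := by positivity
    have hn1 : (1 : ℝ) < n := by exact_mod_cast hn2
    set x : ℝ := (n : ℝ) ^ β with hx
    have hx1 : 1 < x := Real.one_lt_rpow hn1 hβ0
    have hxx : x * x ≤ p n * n := by
      have h1 : x * x ≤ ((n : ℝ) * Real.log n) ^ (1 / d) := by
        rw [hx, ← Real.rpow_add hn0]
        calc (n : ℝ) ^ (β + β) ≤ (n : ℝ) ^ (1 / d) := by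
              refine Real.rpow_le_rpow_of_exponent_le hn1.le ?_
              have : β + β = 1 / k := by rw [hβ]; field_simp; norm_num
              rw [this]
              exact one_div_le_one_div_of_le hd hdk
          _ ≤ ((n : ℝ) * Real.log n) ^ (1 / d) :=
              Real.rpow_le_rpow hn0.le (le_mul_of_one_le_right hn0.le hlog) (by positivity)
      have h2 : 0 < ((n : ℝ) * Real.log n) ^ (1 / d) := by positivity
      rw [le_div_iff₀ h2, one_mul] at hpn
      exact h1.trans hpn
    set L := ⌈x⌉₊ with hL
    have hL2 : 2 ≤ L := Nat.lt_ceil.2 (by simpa using hx1)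
    have hLx : x ≤ L := Nat.le_ceil x
    have hL2x : (L : ℝ) ≤ 2 * x := by
      have := Nat.ceil_lt_add_one (by linarith : 0 ≤ x)
      linarith
    have hpow : n < L ^ (2 * k + 1) := by
      have h1 : x ^ (2 * k) = n := by
        rw [hx, ← Real.rpow_natCast, ← Real.rpow_mul hn0.le]
        have : β * ((2 * k : ℕ) : ℝ) = 1 := by rw [hβ]; push_cast; field_simp
        rw [this, Real.rpow_one]
      have h2 : (n : ℝ) < (L : ℝ) ^ (2 * k + 1) := by
        calc (n : ℝ) = x ^ (2 * k) * 1 := by rw [h1, mul_one]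
          _ < x ^ (2 * k) * x := by gcongr
          _ = x ^ (2 * k + 1) := (pow_succ x _).symm
          _ ≤ (L : ℝ) ^ (2 * k + 1) := by gcongr
      exact_mod_cast h2
    have hmain : (((c * L : ℕ) : ℝ) + 3) * Real.log n ≤ p n * n / 4 := by
      have h1 : ((c * L : ℕ) : ℝ) + 3 ≤ (2 * c + 3) * x := by
        push_cast
        have : (c : ℝ) * L ≤ c * (2 * x) := by gcongr
        linarith
      calc (((c * L : ℕ) : ℝ) + 3) * Real.log n
          ≤ ((2 * c + 3) * x) * (1 / (4 * (2 * c + 3)) * x) :=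
            mul_le_mul h1 hlogβ (by linarith) (by positivity)
        _ = x * x / 4 := by field_simp
        _ ≤ p n * n / 4 := by linarith
    have hcn : c * L ≤ n := by
      have h1 : (p n : ℝ) * n ≤ n := mul_le_of_le_one_left hn0.le (p n).2.2
      have h2 : ((c * L : ℕ) : ℝ) + 3 ≤ (((c * L : ℕ) : ℝ) + 3) * Real.log n :=
        le_mul_of_one_le_right (by positivity) hlog
      have h3 : ((c * L : ℕ) : ℝ) ≤ n := by linarith
      exact_mod_cast h3
    have hbound := binomialRandom_real_not_isExpanding_le (V := Fin n) (p n) (A := c * L)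
      (by simpa using by omega) (by simpa using hmain)
    have hsub : {G : SimpleGraph (Fin n) | ¬ G.IsClassZero}
        ⊆ {G | ¬ G.IsExpanding (c * L)} := by
      intro G hG hexp
      exact hG (hexp.isClassZero (I := 2 * k + 1) hL2 (by simpa using hpow) le_rfl
        (by simpa using hcn))
    have hcompl := measureReal_add_measureReal_compl (μ := binomialRandom (Fin n) (p n))
      (s := {G | G.IsClassZero}) .of_discrete
    rw [probReal_univ, Set.compl_ofPred] at hcompl
    have := (measureReal_mono hsub).trans hbound
    rw [Fintype.card_fin] at this
    linarith
  refine tendsto_of_tendsto_of_tendsto_of_le_of_le' ?_ tendsto_const_nhds hev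
    (.of_forall fun n => measureReal_le_one)
  simpa using (tendsto_const_nhds (x := (1 : ℝ))).sub tendsto_one_div_atTop_nhds_zero_nat

lemma exp_neg_two_mul_le_one_sub {x : ℝ} (h0 : 0 ≤ x) (h : x ≤ 1 / 2) :
    Real.exp (-(2 * x)) ≤ 1 - x := by
  rw [Real.exp_neg]
  refine (inv_anti₀ (by linarith) (Real.add_one_le_exp (2 * x))).trans ?_
  rw [inv_le_iff_one_le_mul₀ (by linarith)]
  nlinarith

/-- In the sparse regime there are isolated vertices: their expected number is at least `√n`. -/
lemma tendsto_binomialRandom_real_isClassZero_zero (p : ℕ → unitInterval)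
    (h : Filter.Tendsto (fun n : ℕ => ((p n : ℝ) * (n : ℝ)) / Real.log (n : ℝ))
        Filter.atTop (nhds 0)) :
    Filter.Tendsto
      (fun n : ℕ => (binomialRandom (Fin n) (p n)).real {G | G.IsClassZero})
      Filter.atTop (nhds 0) := by
  have hlog : Filter.Tendsto (fun n : ℕ => Real.log n) Filter.atTop Filter.atTop :=
    Real.tendsto_log_atTop.comp tendsto_natCast_atTop_atTop
  have hp0 : Filter.Tendsto (fun n : ℕ => (p n : ℝ)) Filter.atTop (nhds 0) := by
    have hlogn : Filter.Tendsto (fun n : ℕ => Real.log n / n) Filter.atTop (nhds 0) := by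
      have := Real.isLittleO_log_id_atTop.tendsto_div_nhds_zero
      exact this.comp tendsto_natCast_atTop_atTop
    have h1 := h.mul hlogn
    rw [mul_zero] at h1
    refine h1.congr' ?_
    filter_upwards [hlog.eventually_gt_atTop 0, Filter.eventually_gt_atTop 0] with n hl hn
    have hn0 : (n : ℝ) ≠ 0 := by positivity
    field_simp
  have hev : ∀ᶠ n : ℕ in Filter.atTop,
      (binomialRandom (Fin n) (p n)).real {G | G.IsClassZero}
        ≤ Real.exp (-(Real.log n / 2)) + (1 / (1 - p n : ℝ) ^ 2 - 1) := by
    filter_upwards [h.eventually_le_const (by norm_num : (0 : ℝ) < 1 / 4),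
      hp0.eventually_le_const (by norm_num : (0 : ℝ) < 1 / 2), hlog.eventually_gt_atTop 0,
      Filter.eventually_ge_atTop 2] with n hpn hp hl hn2
    have hn0 : (0 : ℝ) < n := by positivity
    have : Nontrivial (Fin n) := Fin.nontrivial_iff_two_le.2 hn2
    have hq0 : (0 : ℝ) < 1 - p n := by linarith
    have hsub : {G : SimpleGraph (Fin n) | G.IsClassZero} ⊆ {G | ∀ v, ∃ w, G.Adj v w} := by
      intro G hG v
      by_contra! hv
      exact not_isClassZero_of_isolated hv hG
    refine (measureReal_mono hsub).trans ((binomialRandom_real_no_isolated_le (p n)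
      (by linarith) (by simpa using hn2)).trans (add_le_add_left ?_ _))
    rw [Fintype.card_fin, Real.exp_neg, one_div]
    refine inv_anti₀ (Real.exp_pos _) ?_
    have hpn' : (p n : ℝ) * n ≤ 1 / 4 * Real.log n := (div_le_iff₀ hl).1 hpn
    calc Real.exp (Real.log n / 2) ≤ Real.exp (Real.log n + n * -(2 * p n)) := by
          rw [Real.exp_le_exp]
          linarith
      _ = n * Real.exp (-(2 * p n)) ^ n := by
          rw [Real.exp_add, Real.exp_log hn0, Real.exp_nat_mul]
      _ ≤ n * (1 - p n : ℝ) ^ n := by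
          gcongr
          exact exp_neg_two_mul_le_one_sub (p n).2.1 hp
      _ ≤ n * (1 - p n : ℝ) ^ (n - 1) := by
          gcongr ?_ * ?_
          exact pow_le_pow_of_le_one hq0.le (by linarith [(p n).2.1]) (Nat.sub_le _ _)
  refine tendsto_of_tendsto_of_tendsto_of_le_of_le' tendsto_const_nhds ?_
    (.of_forall fun n => measureReal_nonneg) hev
  have h1 : Filter.Tendsto (fun n : ℕ => Real.exp (-(Real.log n / 2))) Filter.atTop (nhds 0) :=
    Real.tendsto_exp_neg_atTop_nhds_zero.comp (hlog.atTop_div_const (by norm_num))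
  have h2 : Filter.Tendsto (fun n : ℕ => 1 / (1 - p n : ℝ) ^ 2 - 1) Filter.atTop (nhds 0) := by
    have := ((((tendsto_const_nhds (x := (1 : ℝ))).sub hp0).pow 2).inv₀ (by norm_num)).sub
      (tendsto_const_nhds (x := (1 : ℝ)))
    simpa using this
  simpa using h1.add h2

end SimpleGraph

theorem mainTheorem3 (p : ℕ → unitInterval) :
    (∀ d : ℝ, 0 < d →
      Filter.Tendsto
        (fun n : ℕ => ((p n : ℝ) * (n : ℝ)) / ((n : ℝ) * Real.log (n : ℝ)) ^ (1 / d))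
        Filter.atTop Filter.atTop →
      Filter.Tendsto
        (fun n : ℕ => SimpleGraph.binomialRandom (Fin n) (p n)
          {G : SimpleGraph (Fin n) | G.IsClassZero})
        Filter.atTop (nhds 1)) ∧
    (Filter.Tendsto (fun n : ℕ => ((p n : ℝ) * (n : ℝ)) / Real.log (n : ℝ))
        Filter.atTop (nhds 0) →
      Filter.Tendsto
        (fun n : ℕ => SimpleGraph.binomialRandom (Fin n) (p n)
          {G : SimpleGraph (Fin n) | G.IsClassZero})
        Filter.atTop (nhds 0)) := by
  constructor
  · intro d hd h
    refine (ENNReal.tendsto_toReal_iff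
      (fun n => MeasureTheory.measure_ne_top _ _) ENNReal.one_ne_top).1 ?_
    exact SimpleGraph.tendsto_binomialRandom_real_isClassZero p hd h
  · intro h
    refine (ENNReal.tendsto_toReal_iff
      (fun n => MeasureTheory.measure_ne_top _ _) ENNReal.zero_ne_top).1 ?_
    exact SimpleGraph.tendsto_binomialRandom_real_isClassZero_zero p h
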